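/- Let $S$ be a semigroup, and let $S^1$ be $S$ with an identity element adjoined (if it has none). Suppose that - $S$ is regular: for every $x \in S$ there is $y \in S$ with $xyx = x$; - $S$ is group-bound: for every $x \in S$ there is $k \in \{1,2,\dots\}$ such that $x^k$ lies in a subgroup of $S$ (a subsemigroup of $S$ that is a group under the multiplication of $S$); - every $\mathcal{D}$-class of $S$ is finite, where $\mathcal{D} = \mathcal{L}\circ\mathcal{R}$ is Green's relation, with $x \mathrel{\mathcal{L}} y$ iff $S^1x = S^1y$ and $x \mathrel{\mathcal{R}} y$ iff $xS^1 = yS^1$. For $x, y \in S$ write $x \sim_p y$ if there are $u, v \in S^1$ with $x = uv$ and $y = vu$, and let $\sim$ be the transitive closure of $\sim_p$. Write $x \equiv y$ if for every finite-dimensional complex representation $\varphi : S \to \mathrm{End}_{\mathbb{C}}(V)$ (a semigroup homomorphism) one has $\operatorname{tr}\varphi(x) = \operatorname{tr}\varphi(y)$. Then for all $x, y \in S$ we have $x \sim y$ if and only if $x \equiv y$. -/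

import Mathlib

universe u w

namespace SemigroupConj

section

variable {S : Type u} [Semigroup S]

/-- `powSucc x n` is the power `x ^ (n + 1)` in a semigroup; these are all the powers of `x`
with a positive exponent. -/
def powSucc (x : S) : ℕ → S
  | 0 => x
  | n + 1 => powSucc x n * x

/-- A subsemigroup of `S` is a subgroup of `S` if it is a group under the multiplication of `S`
(its identity `e` need not be an identity of `S`). -/
def IsSubgroup (G : Subsemigroup S) : Prop :=
  ∃ e ∈ G, (∀ g ∈ G, e * g = g ∧ g * e = g) ∧ ∀ g ∈ G, ∃ h ∈ G, g * h = e ∧ h * g = e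

variable (S) in
/-- `S` is group-bound: each element has a power, with a positive exponent, that lies in some
subgroup of `S`. -/
def IsGroupBound : Prop :=
  ∀ x : S, ∃ n : ℕ, ∃ G : Subsemigroup S, IsSubgroup G ∧ powSucc x n ∈ G

variable (S) in
/-- `S` is (von Neumann) regular. -/
def IsRegularSemigroup : Prop :=
  ∀ x : S, ∃ y : S, x * y * x = x

/-- Green's relation `L`: `x` and `y` generate the same principal left ideal. In this and
the following definitions `WithOne S` plays the role of `S¹`; if `S` already has an identity, the
additional one does not change any of these relations. -/
def GreenL (x y : S) : Prop :=
  (∃ s : WithOne S, (x : WithOne S) = s * y) ∧ ∃ t : WithOne S, (y : WithOne S) = t * x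

/-- Green's relation `R`: `x` and `y` generate the same principal right ideal. -/
def GreenR (x y : S) : Prop :=
  (∃ s : WithOne S, (x : WithOne S) = y * s) ∧ ∃ t : WithOne S, (y : WithOne S) = x * t

/-- Green's relation `D`, the composition of `L` and `R`. -/
def GreenD (x y : S) : Prop :=
  ∃ z : S, GreenL x z ∧ GreenR z y

variable (S) in
/-- All `D`-classes of `S` are finite. -/
def HasFiniteDClasses : Prop :=
  ∀ x : S, {y : S | GreenD x y}.Finite

/-- Primary conjugacy: `x = uv` and `y = vu` for some `u, v` in `S¹`. -/
def PrimarilyConj (x y : S) : Prop :=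
  ∃ u v : WithOne S, (x : WithOne S) = u * v ∧ (y : WithOne S) = v * u

/-- Conjugacy: the transitive closure of primary conjugacy. -/
def Conj (x y : S) : Prop :=
  Relation.TransGen PrimarilyConj x y

/-- The character of a finite-dimensional complex representation of a semigroup. -/
noncomputable def character {V : Type w} [AddCommGroup V] [Module ℂ V]
    (φ : S →ₙ* Module.End ℂ V) (s : S) : ℂ :=
  LinearMap.trace ℂ V (φ s)

/-- Conjugacy in the character sense: all finite-dimensional complex representations of `S`
have equal characters at `x` and `y`. Representations are semigroup homomorphisms to `End V`;
they are not required to preserve an identity. -/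
def CharacterConj (x y : S) : Prop :=
  ∀ (V : Type w) [AddCommGroup V] [Module ℂ V] [FiniteDimensional ℂ V]
    (φ : S →ₙ* Module.End ℂ V), character φ x = character φ y

end

end SemigroupConj

namespace SemigroupConj

/-! ### Conjugacy, and the invariance of characters under it -/

section Conjugacy

variable {S : Type u} [Semigroup S]

/-! Conjugate elements have equal characters because `tr (AB) = tr (BA)`. For the converse,
regularity and group-boundedness make every element conjugate to a group element
(`IsDrazinInverse.exists_conj_isGroupInverse`), so let `x`, `y` be group elements with idempotents
`e`, `f`. The finite L-class of `e` spans a representation of `S` by left multiplication. Right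
multiplication by `x'`, the group inverse of `x`, commutes with it and has finite order, so the
characters also control the twisted trace, which at `s` counts the `l` with `s l x' = l`. At `x`
this count is positive, `e` being such an `l`; hence some `l` in the class satisfies `y l = l x`
(`CharacterConj.exists_intertwine`). By symmetry some `m` in the L-class of `f` satisfies `x m = m
y`. Group-boundedness then makes `l m` invertible in `f S f`, so `l` is invertible from `e` to `f`
and conjugates `x` to `y` (`conj_of_intertwine`). -/

theorem PrimarilyConj.of_mul (u v : S) : PrimarilyConj (u * v) (v * u) :=
  ⟨u, v, WithOne.coe_mul u v, WithOne.coe_mul v u⟩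

theorem PrimarilyConj.symm {x y : S} (h : PrimarilyConj x y) : PrimarilyConj y x :=
  let ⟨u, v, hx, hy⟩ := h
  ⟨v, u, hy, hx⟩

theorem Conj.of_mul (u v : S) : Conj (u * v) (v * u) :=
  .single (.of_mul u v)

theorem Conj.refl (x : S) : Conj x x :=
  .single ⟨1, x, by simp, by simp⟩

theorem Conj.trans {x y z : S} (h : Conj x y) (h' : Conj y z) : Conj x z :=
  Relation.TransGen.trans h h'

theorem Conj.symm {x y : S} (h : Conj x y) : Conj y x := by
  unfold Conj at h
  induction h with
  | single h => exact .single h.symm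
  | tail _ h ih => exact .head h.symm ih

theorem PrimarilyConj.cases {x y : S} (h : PrimarilyConj x y) :
    x = y ∨ ∃ u v : S, x = u * v ∧ y = v * u := by
  obtain ⟨u, v, hx, hy⟩ := h
  cases u with
  | one =>
    rw [one_mul] at hx
    rw [mul_one] at hy
    exact .inl (WithOne.coe_inj.1 (hx.trans hy.symm))
  | coe u =>
    cases v with
    | one =>
      rw [mul_one] at hx
      rw [one_mul] at hy
      exact .inl (WithOne.coe_inj.1 (hx.trans hy.symm))
    | coe v => exact .inr ⟨u, v, by exact_mod_cast hx, by exact_mod_cast hy⟩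

theorem Conj.characterConj {x y : S} (h : Conj x y) : CharacterConj.{u, w} x y := by
  intro V _ _ _ φ
  unfold Conj at h
  have key : ∀ {x y : S}, PrimarilyConj x y → character φ x = character φ y := by
    intro x y h
    obtain rfl | ⟨u, v, rfl, rfl⟩ := h.cases
    · rfl
    · simp only [character, map_mul]
      exact LinearMap.trace_mul_comm ℂ _ _
  induction h with
  | single h => exact key h
  | tail _ h ih => exact ih.trans (key h)

end Conjugacy

/-! ### Drazin inverses and reduction to group elements -/

section DrazinInverse

variable {S : Type u} [Semigroup S]

/-- `d` is a Drazin inverse of `x`, with `x` of index at most `k + 1`. -/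
structure IsDrazinInverse (x d : S) (k : ℕ) : Prop where
  comm : d * x = x * d
  inner : d * x * d = d
  pow : powSucc x k * (d * x) = powSucc x k

/-- `x'` is the inverse of `x` in some subgroup of `S`. -/
structure IsGroupInverse (x x' : S) : Prop where
  comm : x' * x = x * x'
  inner : x' * x * x' = x'
  outer : x * x' * x = x

theorem powSucc_mul_comm (x : S) (n : ℕ) : powSucc x n * x = x * powSucc x n := by
  induction n with
  | zero => rfl
  | succ n ih => simp only [powSucc]; rw [← mul_assoc, ← ih]

theorem IsGroupBound.exists_isDrazinInverse (hgb : IsGroupBound S) (x : S) :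
    ∃ d k, IsDrazinInverse x d k := by
  obtain ⟨n, G, ⟨e, -, he, hinv⟩, hg⟩ := hgb x
  obtain ⟨g', hg', hgg', hg'g⟩ := hinv _ hg
  obtain ⟨heg, hge⟩ := he _ hg
  obtain ⟨heg', hge'⟩ := he _ hg'
  have hc := powSucc_mul_comm x n
  cases n with
  | zero =>
    simp only [powSucc] at *
    exact ⟨g', 0, hg'g.trans hgg'.symm, by rw [hg'g, heg'], by simp only [powSucc]; rw [hg'g, hge]⟩
  | succ n =>
    set g := powSucc x (n + 1) with hgdef
    -- `e` commutes with `x`, since `e = g' g = g g'` and `g` is a power of `x` that absorbs `e`.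
    have h1 : e * x * e = e * x := by
      calc e * x * e = g' * (g * x) * e := by rw [← hg'g]; simp only [mul_assoc]
        _ = g' * x * (g * e) := by rw [hc]; simp only [mul_assoc]
        _ = g' * (g * x) := by rw [hge, hc]; simp only [mul_assoc]
        _ = e * x := by rw [← hg'g]; simp only [mul_assoc]
    have h2 : e * x * e = x * e := by
      calc e * x * e = e * (x * g) * g' := by rw [← hgg']; simp only [mul_assoc]
        _ = (e * g) * x * g' := by rw [← hc]; simp only [mul_assoc]
        _ = (x * g) * g' := by rw [heg, hc]
        _ = x * e := by rw [← hgg']; simp only [mul_assoc]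
    have hex : e * x = x * e := h1.symm.trans h2
    have hg'x : g' * x = x * g' := by
      calc g' * x = g' * (e * x) := by rw [← mul_assoc, hge']
        _ = g' * (x * g) * g' := by rw [hex, ← hgg']; simp only [mul_assoc]
        _ = (g' * g) * x * g' := by rw [← hc]; simp only [mul_assoc]
        _ = x * (e * g') := by rw [hg'g, hex, mul_assoc]
        _ = x * g' := by rw [heg']
    have hg1 : g = powSucc x n * x := rfl
    have hdx : g' * powSucc x n * x = e := by rw [mul_assoc, ← hg1, hg'g]
    -- `powSucc x n` is one power of `x` below `g`, so this witness times `x` is `e`. When `g = x`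
    -- there is no such lower power in `S`, hence the separate case.
    refine ⟨g' * powSucc x n, n + 1, ?_, ?_, ?_⟩
    · rw [hdx, ← mul_assoc, ← hg'x, mul_assoc, ← powSucc_mul_comm, ← hg1, hg'g]
    · rw [hdx, ← mul_assoc, heg']
    · rw [hdx]; exact hge

/-- Replacing `x = x * y * x` by its conjugate `x * x * y` lowers the index by one. -/
theorem IsDrazinInverse.conj {x d y : S} {k : ℕ} (h : IsDrazinInverse x d (k + 1))
    (hy : x * y * x = x) : IsDrazinInverse (x * x * y) (d * x * y) k := by
  have hy' : ∀ a, x * (y * (x * a)) = x * a := fun a => by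
    rw [← mul_assoc, ← mul_assoc, hy]
  have hd' : ∀ a, d * (x * (d * a)) = d * a := fun a => by
    rw [← mul_assoc, ← mul_assoc, h.inner]
  have hc' : ∀ a, d * (x * a) = x * (d * a) := fun a => by
    rw [← mul_assoc, h.comm, mul_assoc]
  have hpow : ∀ k, powSucc (x * x * y) k = powSucc x (k + 1) * y := by
    intro k
    induction k with
    | zero => rfl
    | succ k ih =>
      rw [powSucc, ih]
      simp only [powSucc, mul_assoc, hy']
  refine ⟨?_, ?_, ?_⟩
  · simp only [mul_assoc, hy']
    rw [hc' (x * y), hc' y, hy']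
  · simp only [mul_assoc, hy']
    rw [hc' y, hy', hc', hd']
  · have h1 : d * x * y * (x * x * y) = x * (d * (x * y)) := by
      simp only [mul_assoc, hy']
      rw [hc' (x * y)]
    rw [h1, hpow]
    have h2 := h.pow
    calc powSucc x (k + 1) * y * (x * (d * (x * y)))
        = powSucc x k * (x * (y * (x * (d * (x * y))))) := by simp only [powSucc, mul_assoc]
      _ = powSucc x (k + 1) * (d * x) * y := by rw [hy']; simp only [powSucc, mul_assoc]
      _ = powSucc x (k + 1) * y := by rw [h2]

theorem IsDrazinInverse.exists_conj_isGroupInverse (hreg : IsRegularSemigroup S) {x d : S} {k : ℕ}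
    (h : IsDrazinInverse x d k) : ∃ a a' : S, IsGroupInverse a a' ∧ Conj x a := by
  induction k generalizing x d with
  | zero =>
    refine ⟨x, d, ⟨h.comm, h.inner, ?_⟩, .refl x⟩
    rw [mul_assoc]
    exact h.pow
  | succ k ih =>
    obtain ⟨y, hy⟩ := hreg x
    obtain ⟨a, a', ha, hxa⟩ := ih (h.conj hy)
    refine ⟨a, a', ha, Conj.trans ?_ hxa⟩
    -- `x = (x y) x` is conjugate to `x (x y)`, whose index is lower.
    have h1 := Conj.of_mul (x * y) x
    rwa [hy, ← mul_assoc] at h1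

theorem powSucc_mul_left_cancel {f w z : S} (hw : w * z = f) (hf : f * z = z) {k : ℕ} {a b : S}
    (ha : f * a = a) (hb : f * b = b) (h : powSucc z k * a = powSucc z k * b) : a = b := by
  have key : ∀ {a b : S}, f * a = a → f * b = b → z * a = z * b → a = b := by
    intro a b ha hb h
    rw [← ha, ← hb, ← hw, mul_assoc, mul_assoc, h]
  induction k generalizing a b with
  | zero => exact key ha hb h
  | succ k ih =>
    simp only [powSucc, mul_assoc] at h
    exact key ha hb (ih (by rw [← mul_assoc, hf]) (by rw [← mul_assoc, hf]) h)

/-- In a group-bound semigroup, a left invertible element of a local monoid `f S f` is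
invertible. -/
theorem IsGroupBound.exists_right_inverse (hgb : IsGroupBound S) {f w z : S} (hw : w * z = f)
    (hfz : f * z = z) (hzf : z * f = z) : ∃ d, z * d = f := by
  obtain ⟨d, k, h⟩ := hgb.exists_isDrazinInverse z
  have hff : f * f = f := by rw [← hw, mul_assoc, hw, hzf, hw]
  -- Cancel the power of `z` on the left of `powSucc z k * (z * d) = powSucc z k * f`.
  refine ⟨d, powSucc_mul_left_cancel (k := k) hw hfz (by rw [← mul_assoc, hfz]) hff ?_⟩
  rw [← h.comm, h.pow]
  cases k with
  | zero => exact hzf.symm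
  | succ k => rw [powSucc, mul_assoc, hzf]

/-- With `e = x x'` and `f = y y'`, the product `l m` has left inverse `s t` in `f S f`, hence a
right inverse. Thus `t f` is a two-sided inverse of `l`: `(t f) l = e` and `l (t f) = f`. Swapping
the factors of `x = (t f y) l` gives `y`. -/
theorem conj_of_intertwine (hgb : IsGroupBound S) {x x' y y' l m s t : S}
    (hx : IsGroupInverse x x') (hy : IsGroupInverse y y')
    (hl : y * l * x' = l) (hle : l * (x * x') = l) (htl : t * l = x * x')
    (hm : x * m * y' = m) (hmf : m * (y * y') = m) (hsm : s * m = y * y') : Conj x y := by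
  have hyl : y * l = l * x := by
    calc y * l = y * l * x' * x := by
          conv_lhs => rw [← hle, ← hx.comm]
          simp only [mul_assoc]
      _ = l * x := by rw [hl]
  have hfl : y * y' * l = l := by
    calc y * y' * l = y * y' * y * l * x' := by
          conv_lhs => rw [← hl]
          simp only [mul_assoc]
      _ = l := by rw [hy.outer, hl]
  have hem : x * x' * m = m := by
    calc x * x' * m = x * x' * x * m * y' := by
          conv_lhs => rw [← hm]
          simp only [mul_assoc]
      _ = m := by rw [hx.outer, hm]
  obtain ⟨d, hd⟩ := hgb.exists_right_inverse (f := y * y') (w := s * t) (z := l * m)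
    (by rw [mul_assoc, ← mul_assoc t, htl, hem, hsm])
    (by rw [← mul_assoc, hfl]) (by rw [mul_assoc, hmf])
  have hlt : l * (t * (y * y')) = y * y' := by
    calc l * (t * (y * y')) = l * (t * l) * (m * d) := by rw [← hd]; simp only [mul_assoc]
      _ = y * y' := by rw [htl, hle, ← mul_assoc, hd]
  have h := Conj.of_mul (t * (y * y') * y) l
  have h1 : t * (y * y') * y * l = x := by
    calc t * (y * y') * y * l = t * (y * y' * y) * l := by simp only [mul_assoc]
      _ = t * l * x := by rw [hy.outer, mul_assoc, hyl, mul_assoc]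
      _ = x := by rw [htl, hx.outer]
  have h2 : l * (t * (y * y') * y) = y := by rw [← mul_assoc, hlt, hy.outer]
  rwa [h1, h2] at h

end DrazinInverse

/-! ### Traces of matrix representations and their twists -/

section Characters

variable {S : Type u} [Semigroup S]

theorem CharacterConj.symm {x y : S} (h : CharacterConj.{u, w} x y) : CharacterConj.{u, w} y x :=
  fun V _ _ _ φ => (h V φ).symm

theorem CharacterConj.trans {x y z : S} (h : CharacterConj.{u, w} x y)
    (h' : CharacterConj.{u, w} y z) : CharacterConj.{u, w} x z :=
  fun V _ _ _ φ => (h V φ).trans (h' V φ)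

theorem CharacterConj.matrix_trace_eq {x y : S} (h : CharacterConj.{u, w} x y) {n : Type*}
    [Fintype n] [DecidableEq n] (ρ : S →ₙ* Matrix n n ℂ) : (ρ x).trace = (ρ y).trace := by
  -- The lift puts the module in the universe `w` over which `CharacterConj` quantifies.
  let ε : n ≃ ULift.{w} (Fin (Fintype.card n)) := (Fintype.equivFin n).trans Equiv.ulift.symm
  let F := (Matrix.reindexAlgEquiv ℂ ℂ ε).trans Matrix.toLinAlgEquiv'
  let φ : S →ₙ* Module.End ℂ (ULift.{w} (Fin (Fintype.card n)) → ℂ) :=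
    { toFun := fun s => F (ρ s)
      map_mul' := fun s t => by rw [map_mul, map_mul] }
  have key : ∀ s, character φ s = (ρ s).trace := by
    intro s
    change LinearMap.trace ℂ _ (Matrix.toLin' (Matrix.reindex ε ε (ρ s))) = _
    rw [Matrix.trace_toLin'_eq]
    simp only [Matrix.trace, Matrix.diag, Matrix.reindex_apply, Matrix.submatrix_apply]
    exact Equiv.sum_comp ε.symm fun i => ρ s i i
  rw [← key, ← key]
  exact h _ φ

open Polynomial in
/-- Polynomials that agree on the `n`-th roots of unity agree at `A` when `A ^ n = 1`. -/
theorem aeval_eq_of_pow_eq_one {R : Type*} [Ring R] [Algebra ℂ R] {A : R} {n : ℕ} (hn : 0 < n)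
    (hA : A ^ n = 1) {p q : ℂ[X]} (hpq : ∀ r ∈ nthRootsFinset n (1 : ℂ), p.eval r = q.eval r) :
    aeval A p = aeval A q := by
  have hdvd : (X ^ n - 1 : ℂ[X]) ∣ p - q := by
    rw [X_pow_sub_one_eq_prod hn (Complex.isPrimitiveRoot_exp n hn.ne')]
    refine Finset.prod_dvd_of_coprime
      (fun a _ b _ hab => pairwise_coprime_X_sub_C Function.injective_id hab) fun r hr => ?_
    rw [dvd_iff_isRoot, IsRoot.def, eval_sub, hpq r hr, sub_self]
  obtain ⟨c, hc⟩ := hdvd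
  rw [← sub_eq_zero, ← map_sub, hc, map_mul, map_sub, map_pow, aeval_X, hA, map_one, sub_self,
    zero_mul]

open Polynomial in
/-- Character equivalence also controls traces twisted by a finite order operator commuting with
the representation. -/
theorem CharacterConj.twisted_trace_eq {x y : S} (h : CharacterConj.{u, w} x y) {n : Type*}
    [Fintype n] [DecidableEq n] (ρ : S →ₙ* Matrix n n ℂ) {A : Matrix n n ℂ} {k : ℕ} (hk : 0 < k)
    (hA : A ^ k = 1) (hcomm : ∀ s, Commute (ρ s) A) :
    (ρ x * A).trace = (ρ y * A).trace := by
  set T := nthRootsFinset k (1 : ℂ)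
  -- Evaluated at `A`, these give the projections onto its eigenspaces.
  let P : ℂ → ℂ[X] := fun r => Lagrange.basis T id r
  have hP : ∀ r ∈ T, ∀ q ∈ T, (P r).eval q = if r = q then 1 else 0 := by
    intro r hr q hq
    split_ifs with hrq
    · subst hrq
      exact Lagrange.eval_basis_self (v := id) Function.injective_id.injOn hr
    · exact Lagrange.eval_basis_of_ne (v := id) hrq hq
  have hidem : ∀ r ∈ T, aeval A (P r) * aeval A (P r) = aeval A (P r) := by
    intro r hr
    rw [← map_mul]
    refine aeval_eq_of_pow_eq_one hk hA fun q hq => ?_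
    rw [eval_mul, hP r hr q hq]
    split_ifs <;> simp
  have hsum : A = ∑ r ∈ T, r • aeval A (P r) := by
    have h1 : aeval A (X : ℂ[X]) = aeval A (∑ r ∈ T, r • P r) := by
      refine aeval_eq_of_pow_eq_one hk hA fun q hq => ?_
      rw [eval_X, eval_finsetSum, Finset.sum_congr rfl fun r hr => by
        rw [eval_smul, hP r hr q hq]]
      simp only [smul_eq_mul, mul_ite, mul_one, mul_zero, Finset.sum_ite_eq']
      exact (if_pos hq).symm
    rw [aeval_X, map_sum] at h1
    simpa only [map_smul] using h1
  have hc : ∀ s p, Commute (ρ s) (aeval A p) := fun s p =>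
    Algebra.commute_of_mem_adjoin_singleton_of_commute (aeval_mem_adjoin_singleton ℂ A) (hcomm s)
  have key : ∀ r ∈ T, (ρ x * aeval A (P r)).trace = (ρ y * aeval A (P r)).trace := by
    intro r hr
    -- The restriction of `ρ` to an eigenspace of `A`, extended by zero.
    let ψ : S →ₙ* Matrix n n ℂ :=
      { toFun := fun s => ρ s * aeval A (P r)
        map_mul' := fun s t => by
          rw [map_mul, mul_assoc (ρ s) _ (ρ t * _), ← mul_assoc _ (ρ t), ← (hc t (P r)).eq, mul_assoc (ρ t),
            hidem r hr, ← mul_assoc] }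
    exact h.matrix_trace_eq ψ
  rw [hsum]
  simp only [Finset.mul_sum, Matrix.trace_sum, Matrix.mul_smul, Matrix.trace_smul]
  exact Finset.sum_congr rfl fun r hr => by rw [key r hr]

end Characters

/-! ### The representation on an L-class and intertwining elements -/

section LeftClass

variable {S : Type u} [Semigroup S]

/-- The `L`-class of an idempotent `e`. -/
def leftClass (e : S) : Set S :=
  {l | l * e = l ∧ ∃ t, t * l = e}

theorem HasFiniteDClasses.finite_leftClass (hD : HasFiniteDClasses S) (e : S) :
    (leftClass e).Finite := by
  refine (hD e).subset ?_
  rintro l ⟨hl, t, ht⟩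
  exact ⟨l, ⟨⟨t, by exact_mod_cast ht.symm⟩, ⟨l, by exact_mod_cast hl.symm⟩⟩,
    ⟨1, by simp⟩, ⟨1, by simp⟩⟩

/-- A product that has left the class cannot return under left multiplication; this makes
`leftClassRep` multiplicative. -/
theorem mem_leftClass_of_mul_mem {e s a : S} (hae : a * e = a) (h : s * a ∈ leftClass e) :
    a ∈ leftClass e :=
  let ⟨t, ht⟩ := h.2
  ⟨hae, t * s, by rw [mul_assoc, ht]⟩

open Classical in
/-- The action of `S` on the `L`-class of `e` by left multiplication, as matrices; products that
leave the class are set to zero. -/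
noncomputable def leftClassRep (e : S) [Fintype (leftClass e)] :
    S →ₙ* Matrix (leftClass e) (leftClass e) ℂ where
  toFun s := Matrix.of fun a b => if s * b.1 = a.1 then 1 else 0
  map_mul' s t := by
    ext a b
    simp only [Matrix.of_apply, Matrix.mul_apply, ← ite_and, ite_mul, one_mul, zero_mul]
    by_cases htb : t * b.1 ∈ leftClass e
    · rw [Finset.sum_eq_single ⟨t * b.1, htb⟩]
      · simp [mul_assoc]
      · rintro c - hc
        rw [if_neg]
        rintro ⟨-, h⟩
        exact hc (Subtype.ext h.symm)
      · simp
    · rw [if_neg, Finset.sum_eq_zero]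
      · rintro c -
        rw [if_neg]
        rintro ⟨-, h⟩
        exact htb (h ▸ c.2)
      · intro h
        refine htb (mem_leftClass_of_mul_mem (s := s) ?_ ?_)
        · rw [mul_assoc, b.2.1]
        · rw [← mul_assoc, h]
          exact a.2

theorem IsGroupInverse.symm {x x' : S} (h : IsGroupInverse x x') : IsGroupInverse x' x :=
  ⟨h.comm.symm, h.outer, h.inner⟩

theorem IsGroupInverse.mul_mem_leftClass {x x' e l : S} (h : IsGroupInverse x x')
    (he : x * x' = e) (hl : l ∈ leftClass e) : l * x ∈ leftClass e := by
  subst he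
  obtain ⟨-, t, ht⟩ := hl
  refine ⟨by rw [mul_assoc, ← h.comm, ← mul_assoc x, h.outer], x' * t, ?_⟩
  rw [mul_assoc, ← mul_assoc t, ht, h.outer, h.comm]

/-- Right multiplication by a group element permutes the `L`-class of its idempotent. -/
def IsGroupInverse.mulRightPerm {x x' : S} (h : IsGroupInverse x x') :
    Equiv.Perm (leftClass (x * x')) where
  toFun l := ⟨l.1 * x, h.mul_mem_leftClass rfl l.2⟩
  invFun l := ⟨l.1 * x', h.symm.mul_mem_leftClass h.comm l.2⟩
  left_inv l := Subtype.ext (by simp only [mul_assoc]; exact l.2.1)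
  right_inv l := Subtype.ext (by simp only [mul_assoc, h.comm]; exact l.2.1)

theorem CharacterConj.exists_intertwine (hD : HasFiniteDClasses S) {x x' y : S}
    (h : CharacterConj.{u, w} x y) (hx : IsGroupInverse x x') :
    ∃ l t, y * l * x' = l ∧ l * (x * x') = l ∧ t * l = x * x' := by
  classical
  have : Fintype (leftClass (x * x')) := (hD.finite_leftClass _).fintype
  let ρ := leftClassRep (x * x')
  let σ := hx.mulRightPerm
  -- In the column convention this matrix sends the basis vector of `b` to that of `b * x'`.
  let A : Matrix (leftClass (x * x')) (leftClass (x * x')) ℂ := σ.permMatrix ℂ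
  have hentry : ∀ s a b, ρ s a b = if s * b.1 = a.1 then 1 else 0 := fun s a b => rfl
  have hρA : ∀ s a b, (ρ s * A) a b = if s * (b.1 * x') = a.1 then 1 else 0 := by
    intro s a b
    have h1 : (ρ s * A) a b = ρ s a (σ.symm b) := by
      simp only [A, Equiv.Perm.permMatrix, PEquiv.mul_toMatrix_toPEquiv]
      rfl
    rw [h1, hentry]
    rfl
  have hAρ : ∀ s a b, (A * ρ s) a b = if s * b.1 = a.1 * x then 1 else 0 := by
    intro s a b
    have h1 : (A * ρ s) a b = ρ s (σ a) b := by
      simp only [A, Equiv.Perm.permMatrix, PEquiv.toMatrix_toPEquiv_mul]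
      rfl
    rw [h1, hentry]
    rfl
  have hcomm : ∀ s, Commute (ρ s) A := by
    intro s
    ext a b
    rw [hρA, hAρ]
    refine if_congr ⟨fun h => ?_, fun h => ?_⟩ rfl rfl
    · rw [← h, mul_assoc, mul_assoc, hx.comm, b.2.1]
    · rw [← mul_assoc, h, mul_assoc, a.2.1]
  have hA : A ^ orderOf σ = 1 := by
    have hpow : ∀ k, (σ ^ k).permMatrix ℂ = A ^ k := by
      intro k
      induction k with
      | zero => simp
      | succ k ih => rw [pow_succ, Matrix.permMatrix_mul, ih, pow_succ']
    rw [← hpow, pow_orderOf_eq_one, Matrix.permMatrix_one]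
  have htr : ∀ s, (ρ s * A).trace =
      ((Finset.univ.filter fun l : leftClass (x * x') => s * (l.1 * x') = l.1).card : ℂ) := by
    intro s
    rw [← Finset.sum_boole]
    exact Finset.sum_congr rfl fun a _ => hρA s a a
  have hcard := h.twisted_trace_eq ρ (orderOf_pos σ) hA hcomm
  rw [htr, htr, Nat.cast_inj] at hcard
  have hee : x * x' * (x * x') = x * x' := by rw [← mul_assoc, hx.outer]
  have hpos : 0 < (Finset.univ.filter
      fun l : leftClass (x * x') => x * (l.1 * x') = l.1).card := by
    -- The idempotent itself is counted: `x e x' = e`.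
    refine Finset.card_pos.2 ⟨⟨x * x', hee, x * x', hee⟩, Finset.mem_filter.2
      ⟨Finset.mem_univ _, ?_⟩⟩
    change x * (x * x' * x') = x * x'
    rw [show x * x' * x' = x' by rw [← hx.comm, hx.inner]]
  rw [hcard] at hpos
  obtain ⟨⟨l, hle, t, ht⟩, hl⟩ := Finset.card_pos.1 hpos
  exact ⟨l, t, by rw [mul_assoc]; exact (Finset.mem_filter.1 hl).2, hle, ht⟩

end LeftClass

end SemigroupConj

theorem theorem1 {S : Type u} [Semigroup S]
    (hreg : SemigroupConj.IsRegularSemigroup S)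
    (hgb : SemigroupConj.IsGroupBound S)
    (hD : SemigroupConj.HasFiniteDClasses S) (x y : S) :
    SemigroupConj.Conj x y ↔ SemigroupConj.CharacterConj.{u, w} x y := by
  refine ⟨fun h => h.characterConj, fun h => ?_⟩
  obtain ⟨d, k, hd⟩ := hgb.exists_isDrazinInverse x
  obtain ⟨a, a', ha, hxa⟩ := hd.exists_conj_isGroupInverse hreg
  obtain ⟨d', k', hd'⟩ := hgb.exists_isDrazinInverse y
  obtain ⟨b, b', hb, hyb⟩ := hd'.exists_conj_isGroupInverse hreg
  have hab : SemigroupConj.CharacterConj.{u, w} a b :=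
    (hxa.characterConj.symm.trans h).trans hyb.characterConj
  obtain ⟨l, t, hl, hle, ht⟩ := hab.exists_intertwine hD ha
  obtain ⟨m, s, hm, hmf, hs⟩ := hab.symm.exists_intertwine hD hb
  exact (hxa.trans (SemigroupConj.conj_of_intertwine hgb ha hb hl hle ht hm hmf hs)).trans hyb.symm
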